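/- A convex polygon is the convex hull $P$ of finitely many points of the Euclidean plane, with nonempty interior; the perimeter of a region is the length of its boundary. A line is an \emph{area bisector} of a convex region $K$ if it divides $K$ into two pieces of equal area, and a \emph{fair bisector} of $K$ if these two pieces also have equal perimeter. Proposition. Let $P$ be a convex polygon. Then there are an angle $\theta\in[0,2\pi)$ and an area bisector of $P$ with direction $(\cos\theta,\sin\theta)$, dividing $P$ into closed pieces $A$ (on its left) and $B$ (on its right), such that for some fair bisector of $A$, dividing $A$ into closed pieces $A_1,A_2$, and some fair bisector of $B$, dividing $B$ into closed pieces $B_1,B_2$, the common perimeter of $A_1,A_2$ equals the common perimeter of $B_1,B_2$. Moreover $A_1,A_2,B_1,B_2$ form a convex fair partition of $P$: they are closed convex sets with pairwise disjoint interiors and union $P$, all of the same area and all of the same perimeter. In particular, every convex polygon can be partitioned into $4$ convex pieces of equal area and equal perimeter. -/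

import Mathlib

open MeasureTheory Set

noncomputable section

/-- The Euclidean plane. -/
abbrev Plane : Type := EuclideanSpace ℝ (Fin 2)

/-- A convex polygon (as a closed region): the convex hull of finitely many points,
with nonempty interior. -/
def IsConvexPolygon (P : Set Plane) : Prop :=
  (∃ s : Set Plane, s.Finite ∧ P = convexHull ℝ s) ∧ (interior P).Nonempty

/-- Area: two-dimensional Lebesgue measure. -/
def area (K : Set Plane) : ENNReal := volume K

/-- Perimeter: the length (one-dimensional Hausdorff measure) of the boundary. -/
def perimeter (K : Set Plane) : ENNReal := μH[1] (frontier K)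

/-- The signed height of `x` over the directed line through the origin with direction
`(cos θ, sin θ)`; positive to the left of that line. The directed line with direction angle `θ`
and offset `c` is the set of points of height `c`. -/
def height (θ : ℝ) (x : Plane) : ℝ := -Real.sin θ * x 0 + Real.cos θ * x 1

/-- The closed piece of `K` to the left of the directed line with direction angle `θ`
and offset `c`. -/
def leftPiece (K : Set Plane) (θ c : ℝ) : Set Plane := {x | x ∈ K ∧ c ≤ height θ x}

/-- The closed piece of `K` to the right of the directed line with direction angle `θ`
and offset `c`. -/
def rightPiece (K : Set Plane) (θ c : ℝ) : Set Plane := {x | x ∈ K ∧ height θ x ≤ c}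

/-- The line `(θ, c)` divides `K` into two pieces of equal area. -/
def IsAreaBisector (K : Set Plane) (θ c : ℝ) : Prop :=
  area (leftPiece K θ c) = area (rightPiece K θ c)

/-- The line `(θ, c)` divides `K` into two pieces of equal area and equal perimeter. -/
def IsFairBisector (K : Set Plane) (θ c : ℝ) : Prop :=
  IsAreaBisector K θ c ∧ perimeter (leftPiece K θ c) = perimeter (rightPiece K θ c)

/-- `Q` is a partition of `P` into `N` closed convex pieces (with pairwise disjoint interiors),
all of the same area and all of the same perimeter. -/
structure IsConvexFairPartition (P : Set Plane) {N : ℕ} (Q : Fin N → Set Plane) : Prop where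
  isClosed : ∀ i, IsClosed (Q i)
  convex : ∀ i, Convex ℝ (Q i)
  iUnion_eq : ⋃ i, Q i = P
  disjoint_interior : ∀ i j, i ≠ j → Disjoint (interior (Q i)) (interior (Q j))
  area_eq : ∀ i j, area (Q i) = area (Q j)
  perimeter_eq : ∀ i j, perimeter (Q i) = perimeter (Q j)

end

/-!
For a convex body `K` and an angle `θ` there is exactly one area bisector with direction `θ`, hence
its offset `bisectorOffset K θ` depends continuously on `θ`, and also on `K`. Turning the direction
by `π` gives the same line with left and right exchanged. So let `leftHalf K θ` be the left half
and `quarter K θ φ = leftHalf (leftHalf K θ) φ`. The right half of `K` is `leftHalf K (θ + π)`, and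
the two pieces of `leftHalf K θ` cut by its bisector in direction `φ` are `quarter K θ φ` and
`quarter K θ (φ + π)`. All these quarters have the same area. It remains to find `θ`, `φ`, `ψ` such
that the function `p θ φ`, the perimeter of `quarter K θ φ`, satisfies
`p θ φ = p θ (φ + π) = p (θ + π) ψ = p (θ + π) (ψ + π)`.

This holds for every continuous function `p` on the torus (`exists_antiperiodic_coincidence`). Let
`f θ φ = p θ φ - p θ (φ + π)` and `g θ φ = p θ φ + p θ (φ + π)`. Since `f θ` is reversed by the
translation by `π`, it has an odd number of sign changes in a half period. If the values of `g` at
the zeros of `f θ` were always different from those at the zeros of `f (θ + π)`, then the parity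
`N θ` of the number of pairs of such zeros with increasing values of `g` would not depend on `θ`;
but `N θ + N (θ + π)` is the parity of the number of all pairs, which is odd. The argument is
carried out on a fine grid, where zeros are replaced by sign changes along edges
(`exists_discrete_coincidence`).

For the continuity of `p`, the boundary of a quarter is cut into a part of the boundary of `K`,
whose length is the measure of a moving intersection of two half planes for the finite measure
`μH[1].restrict (frontier K)`, and two chords, whose lengths are Lebesgue measures of moving subsets
of `ℝ` (`IsBody.perimeter_leftPiece_leftPiece`). Each of these is continuous by dominated
convergence (`continuousAt_measure_of_graph`), because a line through an interior point of `K` meets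
the boundary in a null set, and because the two bisecting lines are distinct. That the boundary of a
polygon has finite length follows from Carathéodory's theorem
(`frontier_convexHull_subset_iUnion_segment`).
-/

open Filter Topology

/-! ### A parity argument on the torus -/

/-- Two neighbouring rows `s`, `s'` of signs, each reversed after `n` steps, have the same weighted
number of sign changes modulo 2, provided that the weights agree around every square of the two
rows on which the signs are not constant. The number of sign changes around a square is even, so
the difference telescopes over the vertical edges. -/
lemma sum_signChange_mul_eq {n : ℕ} {s s' w w' : ℕ → ZMod 2} (hs : s n = s 0 + 1)
    (hs' : s' n = s' 0 + 1) (hw : w n = w 0)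
    (h : ∀ j < n, (s (j + 1) = s j ∧ s' j = s j ∧ s' (j + 1) = s j) ∨
      (w (j + 1) = w j ∧ w' j = w j)) :
    ∑ j ∈ Finset.range n, (s j + s (j + 1)) * w j =
      ∑ j ∈ Finset.range n, (s' j + s' (j + 1)) * w' j := by
  have key : ∀ j ∈ Finset.range n, (s j + s (j + 1)) * w j - (s' j + s' (j + 1)) * w' j =
      (s (j + 1) + s' (j + 1)) * w (j + 1) - (s j + s' j) * w j := by
    intro j hj
    rcases h j (Finset.mem_range.1 hj) with ⟨h1, h2, h3⟩ | ⟨h1, h2⟩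
    · rw [h1, h2, h3, CharTwo.add_self_eq_zero]; ring
    · rw [h1, h2]
      have h0 : ∀ a b c d w : ZMod 2, (a + b) * w - (c + d) * w = (b + d) * w - (a + c) * w := by
        decide
      exact h0 _ _ _ _ _
  rw [← sub_eq_zero, ← Finset.sum_sub_distrib, Finset.sum_congr rfl key,
    Finset.sum_range_sub (fun j => (s j + s' j) * w j), hs, hs', hw]
  have h0 : ∀ a b w : ZMod 2, (a + 1 + (b + 1)) * w - (a + b) * w = 0 := by decide
  exact h0 _ _ _

lemma sum_signChange_eq_one {n : ℕ} {s : ℕ → ZMod 2} (hs : s n = s 0 + 1) :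
    ∑ j ∈ Finset.range n, (s j + s (j + 1)) = 1 := by
  have key : ∀ j ∈ Finset.range n, s j + s (j + 1) = s (j + 1) - s j := fun j _ => by
    rw [CharTwo.sub_eq_add, add_comm]
  rw [Finset.sum_congr rfl key, Finset.sum_range_sub, hs]
  ring

/-- Discrete form of `exists_antiperiodic_coincidence`: the first index has period `2n`, along the
second one `F` is reversed and `G` is repeated after `n` steps, and both vary by less than `η`
between neighbours. Otherwise consider modulo 2 the number `N i (i + n)` of pairs of a sign change
of `F` in row `i` and one in row `i + n` whose `G`-values are in increasing order. It does not
depend on `i`, because the `G`-values of the two rows are separated, whereas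
`N 0 n + N n (n + n)` counts all pairs of sign changes in two rows, an odd number. -/
lemma exists_discrete_coincidence {n : ℕ} (hn : 0 < n) (F G : ℕ → ℕ → ℝ) {η : ℝ}
    (hF : ∀ i, F i n = -F i 0) (hG : ∀ i, G i n = G i 0)
    (hF2 : ∀ j, F (n + n) j = F 0 j) (hG2 : ∀ j, G (n + n) j = G 0 j)
    (hFη : ∀ i i' j j', i ≤ n + n → i' ≤ n + n → j ≤ n → j' ≤ n → i ≤ i' + 1 → i' ≤ i + 1 →
      j ≤ j' + 1 → j' ≤ j + 1 → |F i j - F i' j'| < η)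
    (hGη : ∀ i i' j j', i ≤ n + n → i' ≤ n + n → j ≤ n → j' ≤ n → i ≤ i' + 1 → i' ≤ i + 1 →
      j ≤ j' + 1 → j' ≤ j + 1 → |G i j - G i' j'| < η) :
    ∃ i j k, i ≤ n ∧ j ≤ n ∧ k ≤ n ∧ |F i j| < 2 * η ∧ |F (i + n) k| < 2 * η ∧
      |G i j - G (i + n) k| < η := by
  by_contra! hgap
  -- the sign of `F i j`; the last column is reversed by hand so that this also holds at zeros
  set s : ℕ → ℕ → ZMod 2 := fun i j =>
    if j = n then (if 0 ≤ F i 0 then 1 else 0) + 1 else if 0 ≤ F i j then 1 else 0 with hs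
  have hsn : ∀ i, s i n = s i 0 + 1 := fun i => by simp [hs, hn.ne]
  have two : (1 : ZMod 2) + 1 = 0 := by decide
  have hs01 : ∀ i j, (s i j = 0 ∧ F i j ≤ 0) ∨ (s i j = 1 ∧ 0 ≤ F i j) := by
    intro i j
    by_cases hj : j = n
    · subst hj
      by_cases h : 0 ≤ F i 0
      · left; simp [hs, h, two, hF]
      · right; simp only [hs, h, hF]; simp; linarith
    · by_cases h : 0 ≤ F i j
      · right; simp [hs, hj, h]
      · left; simp [hs, hj, h]; linarith
  have hs2 : ∀ j, s (n + n) j = s 0 j := fun j => by simp [hs, hF2]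
  -- a sign change between neighbouring grid points forces `F` to be small nearby
  have small : ∀ i i' j j', i ≤ n + n → i' ≤ n + n → j ≤ n → j' ≤ n → i ≤ i' + 1 → i' ≤ i + 1 →
      j ≤ j' + 1 → j' ≤ j + 1 → s i' j' ≠ s i j → |F i j| < η := by
    intro i i' j j' h1 h2 h3 h4 h5 h6 h7 h8 hne
    have := abs_lt.1 (hFη i i' j j' h1 h2 h3 h4 h5 h6 h7 h8)
    rw [abs_lt]
    rcases hs01 i j with ⟨a, b⟩ | ⟨a, b⟩ <;> rcases hs01 i' j' with ⟨a', b'⟩ | ⟨a', b'⟩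
    · exact absurd (a'.trans a.symm) hne
    · constructor <;> linarith
    · constructor <;> linarith
    · exact absurd (a'.trans a.symm) hne
  have small_edge : ∀ i j, i ≤ n + n → j < n → s i j + s i (j + 1) ≠ 0 → |F i j| < 2 * η := by
    intro i j hi hj h
    have hne : s i (j + 1) ≠ s i j := by
      intro h'; rw [h'] at h; exact h (CharTwo.add_self_eq_zero _)
    have := small i i j (j + 1) hi hi hj.le hj (by omega) (by omega) (by omega) (by omega) hne
    linarith [abs_nonneg (F i j)]
  have small_square : ∀ i j, i < n + n → j < n →
      (s i (j + 1) = s i j ∧ s (i + 1) j = s i j ∧ s (i + 1) (j + 1) = s i j) ∨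
      (|F i j| < 2 * η ∧ |F i (j + 1)| < 2 * η ∧ |F (i + 1) j| < 2 * η) := by
    intro i j hi hj
    by_cases hall : s i (j + 1) = s i j ∧ s (i + 1) j = s i j ∧ s (i + 1) (j + 1) = s i j
    · exact Or.inl hall
    right
    have h0 : |F i j| < η := by
      by_cases h1 : s i (j + 1) = s i j
      · by_cases h2 : s (i + 1) j = s i j
        · have h3 : s (i + 1) (j + 1) ≠ s i j := fun h3 => hall ⟨h1, h2, h3⟩
          exact small i (i + 1) j (j + 1) (by omega) (by omega) (by omega) (by omega) (by omega)
            (by omega) (by omega) (by omega) h3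
        · exact small i (i + 1) j j (by omega) (by omega) (by omega) (by omega) (by omega)
            (by omega) (by omega) (by omega) h2
      · exact small i i j (j + 1) (by omega) (by omega) (by omega) (by omega) (by omega)
            (by omega) (by omega) (by omega) h1
    have h1 := hFη i i j (j + 1) (by omega) (by omega) (by omega) (by omega) (by omega)
            (by omega) (by omega) (by omega)
    have h2 := hFη i (i + 1) j j (by omega) (by omega) (by omega) (by omega) (by omega)
            (by omega) (by omega) (by omega)
    rw [abs_lt] at h0 h1 h2
    refine ⟨?_, ?_, ?_⟩ <;> rw [abs_lt] <;> constructor <;> linarith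
  -- pairs of sign changes in rows `i` and `i'` with increasing values of `G`, modulo 2
  set N : ℕ → ℕ → ZMod 2 := fun i i' => ∑ j ∈ Finset.range n, ∑ k ∈ Finset.range n,
    (s i j + s i (j + 1)) * ((s i' k + s i' (k + 1)) * if G i j < G i' k then 1 else 0) with hN
  -- order comparisons with a separated value are unaffected by a small change
  have lt_iff : ∀ {a b c : ℝ}, |a - b| < η → η ≤ |a - c| → (b < c ↔ a < c) := by
    intro a b c h1 h2
    rw [abs_lt] at h1
    rcases le_abs.1 h2 with h | h
    · constructor <;> intro h' <;> linarith
    · constructor <;> intro h' <;> linarith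
  have gt_iff : ∀ {a b c : ℝ}, |a - b| < η → η ≤ |c - a| → (c < b ↔ c < a) := by
    intro a b c h1 h2
    rw [abs_lt] at h1
    rcases le_abs.1 h2 with h | h
    · constructor <;> intro h' <;> linarith
    · constructor <;> intro h' <;> linarith
  have step1 : ∀ i < n, N i (i + n) = N (i + 1) (i + n) := by
    intro i hi
    simp only [hN, ← Finset.mul_sum]
    apply sum_signChange_mul_eq (s := s i) (s' := s (i + 1))
      (w := fun j => ∑ k ∈ Finset.range n, (s (i + n) k + s (i + n) (k + 1)) *
        if G i j < G (i + n) k then 1 else 0)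
      (w' := fun j => ∑ k ∈ Finset.range n, (s (i + n) k + s (i + n) (k + 1)) *
        if G (i + 1) j < G (i + n) k then 1 else 0) (hsn _) (hsn _)
    · simp only [hG]
    · intro j hj
      rcases small_square i j (by omega) hj with h | ⟨h0, h1, h2⟩
      · exact Or.inl h
      · right
        constructor
        · refine Finset.sum_congr rfl fun k hk => ?_
          have hk := Finset.mem_range.1 hk
          by_cases hc : s (i + n) k + s (i + n) (k + 1) = 0
          · rw [hc, zero_mul, zero_mul]
          · have hgap' := hgap i j k hi.le hj.le hk.le h0 (small_edge (i + n) k (by omega) hk hc)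
            rw [if_congr (lt_iff (hGη i i j (j + 1) (by omega) (by omega) (by omega) (by omega)
              (by omega) (by omega) (by omega) (by omega)) hgap') rfl rfl]
        · refine Finset.sum_congr rfl fun k hk => ?_
          have hk := Finset.mem_range.1 hk
          by_cases hc : s (i + n) k + s (i + n) (k + 1) = 0
          · rw [hc, zero_mul, zero_mul]
          · have hgap' := hgap i j k hi.le hj.le hk.le h0 (small_edge (i + n) k (by omega) hk hc)
            rw [if_congr (lt_iff (hGη i (i + 1) j j (by omega) (by omega) (by omega) (by omega)
              (by omega) (by omega) (by omega) (by omega)) hgap') rfl rfl]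
  have swap : ∀ i i', N i i' = ∑ k ∈ Finset.range n, (s i' k + s i' (k + 1)) *
      ∑ j ∈ Finset.range n, (s i j + s i (j + 1)) * if G i j < G i' k then 1 else 0 := by
    intro i i'
    simp only [hN]
    rw [Finset.sum_comm]
    refine Finset.sum_congr rfl fun k _ => ?_
    rw [Finset.mul_sum]
    refine Finset.sum_congr rfl fun j _ => ?_
    ring
  have step2 : ∀ i < n, N (i + 1) (i + n) = N (i + 1) (i + 1 + n) := by
    intro i hi
    rw [swap, swap, show i + 1 + n = i + n + 1 by ring]
    symm
    -- the square is entered from its far side, so that the gap applies on the row `i + n + 1`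
    have hrow : ∀ j k, j < n → k ≤ n → s (i + 1) j + s (i + 1) (j + 1) ≠ 0 →
        |F (i + n + 1) k| < 2 * η → η ≤ |G (i + 1) j - G (i + n + 1) k| := by
      intro j k hj hk hc hF
      have := hgap (i + 1) j k hi hj.le hk (small_edge (i + 1) j (by omega) hj hc)
      rw [show i + 1 + n = i + n + 1 by ring] at this
      exact this hF
    apply sum_signChange_mul_eq (s := s (i + n + 1)) (s' := s (i + n))
      (w := fun k => ∑ j ∈ Finset.range n, (s (i + 1) j + s (i + 1) (j + 1)) *
        if G (i + 1) j < G (i + n + 1) k then 1 else 0)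
      (w' := fun k => ∑ j ∈ Finset.range n, (s (i + 1) j + s (i + 1) (j + 1)) *
        if G (i + 1) j < G (i + n) k then 1 else 0) (hsn _) (hsn _)
    · simp only [hG]
    · intro k hk
      rcases small_square (i + n) k (by omega) hk with ⟨h1, h2, h3⟩ | ⟨h0, h1, h2⟩
      · left; rw [h1, h2, h3]; simp
      · right
        constructor
        · refine Finset.sum_congr rfl fun j hj => ?_
          have hj := Finset.mem_range.1 hj
          by_cases hc : s (i + 1) j + s (i + 1) (j + 1) = 0
          · rw [hc, zero_mul, zero_mul]
          · rw [if_congr (gt_iff (hGη (i + n + 1) (i + n + 1) k (k + 1) (by omega) (by omega)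
              (by omega) (by omega) (by omega) (by omega) (by omega) (by omega))
              (hrow j k hj hk.le hc h2)) rfl rfl]
        · refine Finset.sum_congr rfl fun j hj => ?_
          have hj := Finset.mem_range.1 hj
          by_cases hc : s (i + 1) j + s (i + 1) (j + 1) = 0
          · rw [hc, zero_mul, zero_mul]
          · rw [if_congr (gt_iff (hGη (i + n + 1) (i + n) k k (by omega) (by omega)
              (by omega) (by omega) (by omega) (by omega) (by omega) (by omega))
              (hrow j k hj hk.le hc h2)) rfl rfl]
  have const : ∀ i ≤ n, N i (i + n) = N 0 n := by
    intro i
    induction i with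
    | zero => intro _; rw [zero_add]
    | succ i ih =>
      intro hi
      rw [← step2 i hi, ← step1 i hi, ih (by omega)]
  have hsum : N 0 n + N n (n + n) = 1 := by
    rw [swap n (n + n)]
    simp only [hN, hs2, hG2, ← Finset.sum_add_distrib, Finset.mul_sum]
    have : ∀ j ∈ Finset.range n, ∀ k ∈ Finset.range n,
        (s 0 j + s 0 (j + 1)) * ((s n k + s n (k + 1)) * if G 0 j < G n k then 1 else 0) +
        (s 0 j + s 0 (j + 1)) * ((s n k + s n (k + 1)) * if G n k < G 0 j then 1 else 0) =
        (s 0 j + s 0 (j + 1)) * (s n k + s n (k + 1)) := by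
      intro j hj k hk
      have hj := Finset.mem_range.1 hj
      have hk := Finset.mem_range.1 hk
      by_cases hc : s 0 j + s 0 (j + 1) = 0
      · simp [hc]
      by_cases hd : s n k + s n (k + 1) = 0
      · simp [hd]
      have h1 := small_edge 0 j (by omega) hj hc
      have h2 := small_edge n k (by omega) hk hd
      have h3 := hgap 0 j k (by omega) hj.le hk.le h1 (by rwa [zero_add])
      rw [zero_add] at h3
      have hη : 0 < η := lt_of_le_of_lt (abs_nonneg _) (hFη 0 0 0 0 (by omega) (by omega)
        (by omega) (by omega) (by omega) (by omega) (by omega) (by omega))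
      have hne : G 0 j ≠ G n k := by
        intro h; rw [h, sub_self, abs_zero] at h3; linarith
      rcases lt_or_gt_of_ne hne with h | h
      · simp [h, h.not_gt]
      · simp [h, h.not_gt]
    rw [Finset.sum_congr rfl fun j hj => Finset.sum_congr rfl (this j hj), ← Finset.sum_mul_sum,
      sum_signChange_eq_one (hsn 0), sum_signChange_eq_one (hsn n), one_mul]
  rw [const n le_rfl, CharTwo.add_self_eq_zero] at hsum
  exact zero_ne_one hsum

/-- For a continuous function on the torus, there are two points at opposite first coordinates such
that `p` takes one common value at these points and at their translates by `π` in the second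
coordinate. -/
theorem exists_antiperiodic_coincidence (p : ℝ → ℝ → ℝ) (hp : Continuous fun z : ℝ × ℝ => p z.1 z.2)
    (hp1 : ∀ θ φ, p (θ + 2 * Real.pi) φ = p θ φ) (hp2 : ∀ θ φ, p θ (φ + 2 * Real.pi) = p θ φ) :
    ∃ θ φ ψ, p θ φ = p θ (φ + Real.pi) ∧
      p (θ + Real.pi) ψ = p (θ + Real.pi) (ψ + Real.pi) ∧ p θ φ = p (θ + Real.pi) ψ := by
  have hpi := Real.pi_pos
  set f : ℝ × ℝ → ℝ := fun z => p z.1 z.2 - p z.1 (z.2 + Real.pi) with hf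
  set g : ℝ × ℝ → ℝ := fun z => p z.1 z.2 + p z.1 (z.2 + Real.pi) with hg
  have hpc : Continuous fun z : ℝ × ℝ => p z.1 (z.2 + Real.pi) :=
    hp.comp (by fun_prop : Continuous fun z : ℝ × ℝ => (z.1, z.2 + Real.pi))
  have hfc : Continuous f := hp.sub hpc
  have hgc : Continuous g := hp.add hpc
  set h : ℝ × ℝ × ℝ → ℝ := fun x => |f (x.1, x.2.1)| + |f (x.1 + Real.pi, x.2.2)| +
    |g (x.1, x.2.1) - g (x.1 + Real.pi, x.2.2)| with hh
  have hhc : Continuous h := by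
    have e1 : Continuous fun x : ℝ × ℝ × ℝ => (x.1, x.2.1) := by fun_prop
    have e2 : Continuous fun x : ℝ × ℝ × ℝ => (x.1 + Real.pi, x.2.2) := by fun_prop
    exact ((hfc.comp e1).abs.add (hfc.comp e2).abs).add ((hgc.comp e1).sub (hgc.comp e2)).abs
  set I := Icc (0 : ℝ) (2 * Real.pi) with hI
  have hIc : IsCompact I := isCompact_Icc
  have h0I : (0 : ℝ) ∈ I := ⟨le_rfl, by positivity⟩
  obtain ⟨x, hx, hmin⟩ := (hIc.prod (hIc.prod hIc)).exists_isMinOn ⟨(0, 0, 0), h0I, h0I, h0I⟩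
    hhc.continuousOn
  rcases eq_or_lt_of_le (show 0 ≤ h x by positivity) with h0 | h0
  · have a1 := abs_nonneg (f (x.1, x.2.1))
    have a2 := abs_nonneg (f (x.1 + Real.pi, x.2.2))
    have a3 := abs_nonneg (g (x.1, x.2.1) - g (x.1 + Real.pi, x.2.2))
    have b1 : f (x.1, x.2.1) = 0 := abs_eq_zero.1 (by simp only [hh] at h0; linarith)
    have b2 : f (x.1 + Real.pi, x.2.2) = 0 := abs_eq_zero.1 (by simp only [hh] at h0; linarith)
    have b3 : g (x.1, x.2.1) - g (x.1 + Real.pi, x.2.2) = 0 :=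
      abs_eq_zero.1 (by simp only [hh] at h0; linarith)
    simp only [hf, hg] at b1 b2 b3
    refine ⟨x.1, x.2.1, x.2.2, ?_, ?_, ?_⟩ <;> linarith
  -- otherwise the three defects cannot all be small, contrary to the discrete statement on a fine
  -- grid
  exfalso
  set η := h x / 5 with hη
  have hη0 : 0 < η := by positivity
  have hfg : Continuous fun z => (f z, g z) := hfc.prodMk hgc
  obtain ⟨δ, hδ, hunif⟩ := Metric.uniformContinuousOn_iff.1
    ((hIc.prod hIc).uniformContinuousOn_of_continuous hfg.continuousOn) η hη0
  obtain ⟨m, hm⟩ := exists_nat_gt (Real.pi / δ)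
  have hm0 : (0 : ℝ) < m := lt_trans (by positivity) hm
  have hm1 : 0 < m := by exact_mod_cast hm0
  set a : ℝ := Real.pi / m with ha
  have ha0 : 0 < a := by positivity
  have hma : m * a = Real.pi := by rw [ha]; field_simp
  have haδ : a < δ := by
    rw [ha, div_lt_iff₀ hm0]; rw [div_lt_iff₀ hδ] at hm; linarith
  have mem : ∀ i : ℕ, i ≤ m + m → (i : ℝ) * a ∈ I := by
    intro i hi
    have : (i : ℝ) ≤ m + m := by exact_mod_cast hi
    refine ⟨by positivity, ?_⟩
    nlinarith
  have near : ∀ i i' : ℕ, i ≤ i' + 1 → i' ≤ i + 1 → dist ((i : ℝ) * a) (i' * a) < δ := by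
    intro i i' h1 h2
    have h1' : (i : ℝ) ≤ i' + 1 := by exact_mod_cast h1
    have h2' : (i' : ℝ) ≤ i + 1 := by exact_mod_cast h2
    rw [Real.dist_eq, abs_lt]
    constructor <;> nlinarith
  have close : ∀ i i' j j' : ℕ, i ≤ m + m → i' ≤ m + m → j ≤ m → j' ≤ m → i ≤ i' + 1 →
      i' ≤ i + 1 → j ≤ j' + 1 → j' ≤ j + 1 →
      |f (i * a, j * a) - f (i' * a, j' * a)| < η ∧
        |g (i * a, j * a) - g (i' * a, j' * a)| < η := by
    intro i i' j j' h1 h2 h3 h4 h5 h6 h7 h8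
    have := hunif (i * a, j * a) ⟨mem i h1, mem j (by omega)⟩ (i' * a, j' * a)
      ⟨mem i' h2, mem j' (by omega)⟩ (max_lt (near i i' h5 h6) (near j j' h7 h8))
    exact max_lt_iff.1 this
  have hshift : ∀ t φ, p t (φ + Real.pi + Real.pi) = p t φ := fun t φ => by
    rw [← hp2 t φ]; congr 1; ring
  obtain ⟨i, j, k, hi, hj, hk, e1, e2, e3⟩ := exists_discrete_coincidence hm1
    (fun i j => f (i * a, j * a)) (fun i j => g (i * a, j * a)) (η := η)
    (by intro i
        have := hshift (i * a) 0
        rw [zero_add] at this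
        simp only [hf, hma, CharP.cast_eq_zero, zero_mul, zero_add, this]; ring)
    (by intro i
        have := hshift (i * a) 0
        rw [zero_add] at this
        simp only [hg, hma, CharP.cast_eq_zero, zero_mul, zero_add, this]; ring)
    (by intro j
        have e : ((m + m : ℕ) : ℝ) * a = 0 + 2 * Real.pi := by push_cast; linarith
        simp only [hf, e, hp1, CharP.cast_eq_zero, zero_mul])
    (by intro j
        have e : ((m + m : ℕ) : ℝ) * a = 0 + 2 * Real.pi := by push_cast; linarith
        simp only [hg, e, hp1, CharP.cast_eq_zero, zero_mul])
    (fun i i' j j' h1 h2 h3 h4 h5 h6 h7 h8 => (close i i' j j' h1 h2 h3 h4 h5 h6 h7 h8).1)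
    (fun i i' j j' h1 h2 h3 h4 h5 h6 h7 h8 => (close i i' j j' h1 h2 h3 h4 h5 h6 h7 h8).2)
  have hle : h x ≤ h (i * a, j * a, k * a) := hmin
    (show ((i : ℝ) * a, (j : ℝ) * a, (k : ℝ) * a) ∈ I ×ˢ I ×ˢ I from
    ⟨mem i (by omega), mem j (by omega), mem k (by omega)⟩)
  have e : ((i + m : ℕ) : ℝ) * a = i * a + Real.pi := by push_cast; linarith
  simp only [e] at e2 e3
  simp only [hh] at hle
  have : h x = 5 * η := by rw [hη]; ring
  simp only [hh] at this
  linarith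

/-! ### Half planes and lines -/

lemma Continuous.height {X : Type*} [TopologicalSpace X] {f : X → ℝ} {g : X → Plane}
    (hf : Continuous f) (hg : Continuous g) : Continuous fun x => _root_.height (f x) (g x) :=
  ((Real.continuous_sin.comp hf).neg.mul (by fun_prop)).add
    ((Real.continuous_cos.comp hf).mul (by fun_prop))

lemma isLinearMap_height (θ : ℝ) : IsLinearMap ℝ (height θ) where
  map_add x y := by simp [height]; ring
  map_smul a x := by simp [height]; ring

lemma height_add_pi (θ : ℝ) (x : Plane) : height (θ + Real.pi) x = -height θ x := by
  simp [height]; ring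

lemma leftPiece_add_pi (K : Set Plane) (θ c : ℝ) :
    leftPiece K (θ + Real.pi) c = rightPiece K θ (-c) := by
  ext x; simp only [leftPiece, rightPiece, height_add_pi, mem_ofPred_eq, le_neg]

lemma rightPiece_add_pi (K : Set Plane) (θ c : ℝ) :
    rightPiece K (θ + Real.pi) c = leftPiece K θ (-c) := by
  ext x; simp only [leftPiece, rightPiece, height_add_pi, mem_ofPred_eq, neg_le]

/-- The arc length parametrization of the line with direction angle `θ` and offset `c`. -/
noncomputable def linePoint (θ c t : ℝ) : Plane :=
  !₂[-c * Real.sin θ + t * Real.cos θ, c * Real.cos θ + t * Real.sin θ]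

@[fun_prop]
lemma Continuous.linePoint {X : Type*} [TopologicalSpace X] {f g h : X → ℝ}
    (hf : Continuous f) (hg : Continuous g) (hh : Continuous h) :
    Continuous fun x => _root_.linePoint (f x) (g x) (h x) := by
  unfold _root_.linePoint
  refine (PiLp.continuous_toLp 2 _).comp (continuous_pi fun i => ?_)
  fin_cases i
  · simp; fun_prop
  · simp; fun_prop

lemma height_linePoint (φ θ c t : ℝ) :
    height φ (linePoint θ c t) = c * Real.cos (φ - θ) - t * Real.sin (φ - θ) := by
  simp [height, linePoint, Real.cos_sub, Real.sin_sub]; ring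

@[simp]
lemma height_linePoint_self (θ c t : ℝ) : height θ (linePoint θ c t) = c := by
  simp [height_linePoint]

lemma norm_sq_linePoint (θ c t : ℝ) : ‖linePoint θ c t‖ ^ 2 = c ^ 2 + t ^ 2 := by
  rw [EuclideanSpace.norm_sq_eq]
  simp [linePoint]
  linear_combination (c ^ 2 + t ^ 2) * Real.sin_sq_add_cos_sq θ

lemma linePoint_sub (θ c s t : ℝ) :
    linePoint θ c s - linePoint θ c t = linePoint θ 0 (s - t) := by
  ext i; fin_cases i <;> simp [linePoint] <;> ring

lemma isometry_linePoint (θ c : ℝ) : Isometry (linePoint θ c) := by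
  refine Isometry.of_dist_eq fun s t => ?_
  rw [dist_eq_norm, linePoint_sub, Real.dist_eq]
  have h := norm_sq_linePoint θ 0 (s - t)
  rw [zero_pow two_ne_zero, zero_add, ← sq_abs (s - t)] at h
  exact (sq_eq_sq₀ (norm_nonneg _) (abs_nonneg _)).1 h

lemma exists_linePoint_eq (θ : ℝ) (x : Plane) : ∃ t, linePoint θ (height θ x) t = x := by
  refine ⟨x 0 * Real.cos θ + x 1 * Real.sin θ, ?_⟩
  ext i; fin_cases i
  · simp [linePoint, height]
    linear_combination (x 0) * Real.sin_sq_add_cos_sq θ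
  · simp [linePoint, height]
    linear_combination (x 1) * Real.sin_sq_add_cos_sq θ

lemma image_linePoint_preimage (θ c : ℝ) (S : Set Plane) :
    linePoint θ c '' {t | linePoint θ c t ∈ S} = S ∩ {x | height θ x = c} := by
  ext x
  constructor
  · rintro ⟨t, ht, rfl⟩
    exact ⟨ht, height_linePoint_self θ c t⟩
  · rintro ⟨hx, hc⟩
    obtain ⟨t, ht⟩ := exists_linePoint_eq θ x
    rw [show height θ x = c from hc] at ht
    exact ⟨t, by rw [mem_ofPred_eq, ht]; exact hx, ht⟩

lemma hausdorffMeasure_inter_line (θ c : ℝ) (S : Set Plane) :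
    μH[1] (S ∩ {x | height θ x = c}) = volume {t | linePoint θ c t ∈ S} := by
  rw [← image_linePoint_preimage, (isometry_linePoint θ c).hausdorffMeasure_image
    (Or.inl zero_le_one), hausdorffMeasure_real]

lemma isOpenMap_height (θ : ℝ) : IsOpenMap (height θ) :=
  LinearMap.isOpenMap_of_finiteDimensional (isLinearMap_height θ).mk' fun t =>
    ⟨linePoint θ t 0, height_linePoint_self θ t 0⟩

lemma interior_leftPiece (K : Set Plane) (θ c : ℝ) :
    interior (leftPiece K θ c) = interior K ∩ {x | c < height θ x} := by
  have h := (isOpenMap_height θ).preimage_interior_eq_interior_preimage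
    (continuous_const.height continuous_id) (Ici c)
  rw [interior_Ici] at h
  rw [show leftPiece K θ c = K ∩ height θ ⁻¹' Ici c from rfl, interior_inter, ← h]
  rfl

lemma interior_rightPiece (K : Set Plane) (θ c : ℝ) :
    interior (rightPiece K θ c) = interior K ∩ {x | height θ x < c} := by
  have h := leftPiece_add_pi K θ (-c)
  rw [neg_neg] at h
  rw [← h, interior_leftPiece]
  simp only [height_add_pi, neg_lt_neg_iff]

lemma leftPiece_union_rightPiece (K : Set Plane) (θ c : ℝ) :
    leftPiece K θ c ∪ rightPiece K θ c = K := by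
  ext x
  simp only [leftPiece, rightPiece, mem_union, mem_ofPred_eq, ← and_or_left, le_total, and_true]

lemma isClosed_leftPiece {K : Set Plane} (hK : IsClosed K) (θ c : ℝ) :
    IsClosed (leftPiece K θ c) :=
  hK.inter (isClosed_le continuous_const (continuous_const.height continuous_id))

lemma isClosed_rightPiece {K : Set Plane} (hK : IsClosed K) (θ c : ℝ) :
    IsClosed (rightPiece K θ c) :=
  hK.inter (isClosed_le (continuous_const.height continuous_id) continuous_const)

lemma convex_leftPiece {K : Set Plane} (hK : Convex ℝ K) (θ c : ℝ) :
    Convex ℝ (leftPiece K θ c) :=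
  hK.inter (convex_halfSpace_ge (isLinearMap_height θ) c)

lemma leftPiece_anti (K : Set Plane) (θ : ℝ) {c d : ℝ} (h : c ≤ d) :
    leftPiece K θ d ⊆ leftPiece K θ c := fun _ hx => ⟨hx.1, h.trans hx.2⟩

lemma rightPiece_mono (K : Set Plane) (θ : ℝ) {c d : ℝ} (h : c ≤ d) :
    rightPiece K θ c ⊆ rightPiece K θ d := fun _ hx => ⟨hx.1, hx.2.trans h⟩

/-! ### Convex bodies and their area bisectors -/

/-- Continuity of the measure of a set varying with a parameter `x`: it suffices that `S x` has
closed graph and contains `O x` with open graph, and that the difference is null at the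
parameter considered. -/
lemma continuousAt_measure_of_graph {X Y : Type*} [TopologicalSpace X] [FirstCountableTopology X]
    [TopologicalSpace Y] [MeasurableSpace Y] [BorelSpace Y] {ν : Measure Y} {S O : X → Set Y}
    {B : Set Y} (hBm : MeasurableSet B) (hB : ν B ≠ ⊤) (hSB : ∀ x, S x ⊆ B)
    (hS : IsClosed {z : X × Y | z.2 ∈ S z.1}) (hO : IsOpen {z : X × Y | z.2 ∈ O z.1})
    (hOS : ∀ x, O x ⊆ S x) {x₀ : X} (h0 : ν (S x₀ \ O x₀) = 0) :
    ContinuousAt (fun x => ν (S x)) x₀ := by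
  have hm : ∀ x, MeasurableSet (S x) := fun x =>
    (hS.preimage (by fun_prop : Continuous fun y : Y => (x, y))).measurableSet
  refine tendsto_measure_of_ae_tendsto_indicator _ (hm x₀) hm hBm hB
    (Eventually.of_forall hSB) ?_
  have hae : ∀ᵐ y ∂ν, y ∉ S x₀ \ O x₀ := measure_eq_zero_iff_ae_notMem.1 h0
  filter_upwards [hae] with y hy
  have hc : Continuous fun x : X => (x, y) := by fun_prop
  by_cases hyS : y ∈ S x₀
  · have hyO : y ∈ O x₀ := by
      by_contra h; exact hy ⟨hyS, h⟩
    filter_upwards [(hO.preimage hc).mem_nhds hyO] with x hx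
    exact iff_of_true (hOS x hx) hyS
  · filter_upwards [(hS.isOpen_compl.preimage hc).mem_nhds hyS] with x hx
    exact iff_of_false hx hyS

/-- A planar convex body. -/
structure IsBody (K : Set Plane) : Prop where
  convex : Convex ℝ K
  isCompact : IsCompact K
  nonempty_interior : (interior K).Nonempty

lemma IsBody.area_ne_top {K : Set Plane} (hK : IsBody K) : area K ≠ ⊤ :=
  hK.isCompact.measure_lt_top.ne

lemma IsBody.area_pos {K : Set Plane} (hK : IsBody K) : 0 < area K :=
  Measure.measure_pos_of_nonempty_interior _ hK.nonempty_interior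

lemma area_rightPiece_add_pi (K : Set Plane) (θ c : ℝ) :
    area (rightPiece K θ c) = area (leftPiece K (θ + Real.pi) (-c)) := by
  rw [leftPiece_add_pi, neg_neg]

lemma isAreaBisector_add_pi {K : Set Plane} {θ c : ℝ} :
    IsAreaBisector K (θ + Real.pi) c ↔ IsAreaBisector K θ (-c) := by
  rw [IsAreaBisector, IsAreaBisector, leftPiece_add_pi, rightPiece_add_pi, eq_comm]

/-- The frontier of a convex set is null, so a piece of positive area contains interior points of
the whole set. -/
lemma exists_mem_interior_of_area_leftPiece_ne_zero {K : Set Plane} (hK : Convex ℝ K) {θ c : ℝ}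
    (h : area (leftPiece K θ c) ≠ 0) : ∃ x ∈ interior K, c ≤ height θ x := by
  by_contra! hx
  refine h (measure_mono_null (fun y hy => ?_) (hK.addHaar_frontier volume))
  exact ⟨subset_closure hy.1, fun hi => (hx y hi).not_ge hy.2⟩

lemma IsBody.exists_mem_interior_of_isAreaBisector {K : Set Plane} (hK : IsBody K) {θ c : ℝ}
    (h : IsAreaBisector K θ c) : ∃ x ∈ interior K, height θ x = c := by
  have hl : area (leftPiece K θ c) ≠ 0 := by
    intro h0
    have h1 : area K ≤ area (leftPiece K θ c) + area (rightPiece K θ c) := by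
      conv_lhs => rw [← leftPiece_union_rightPiece K θ c]
      exact measure_union_le _ _
    rw [← h, h0, add_zero] at h1
    exact hK.area_pos.not_ge h1
  have hr : area (leftPiece K (θ + Real.pi) (-c)) ≠ 0 := by
    rwa [← area_rightPiece_add_pi, ← h]
  obtain ⟨x, hx, hxc⟩ := exists_mem_interior_of_area_leftPiece_ne_zero hK.convex hl
  obtain ⟨y, hy, hyc⟩ := exists_mem_interior_of_area_leftPiece_ne_zero hK.convex hr
  rw [height_add_pi, neg_le_neg_iff] at hyc
  obtain ⟨z, hz, hzc⟩ := hK.convex.interior.isPreconnected.intermediate_value hy hx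
    (continuous_const.height continuous_id : Continuous (height θ)).continuousOn ⟨hyc, hxc⟩
  exact ⟨z, hz, hzc⟩

lemma exists_mem_open_height_gt {U : Set Plane} (hU : IsOpen U) {θ c : ℝ} {x : Plane}
    (hx : x ∈ U) (hc : height θ x = c) {d : ℝ} (hd : c < d) :
    ∃ y ∈ U, c < height θ y ∧ height θ y < d := by
  obtain ⟨t, ht⟩ := exists_linePoint_eq θ x
  rw [hc] at ht
  have hcont : Continuous fun e => linePoint θ e t := by fun_prop
  have h1 : ∀ᶠ e in 𝓝[>] c, linePoint θ e t ∈ U :=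
    (hcont.tendsto c).mono_left nhdsWithin_le_nhds (hU.mem_nhds (by rwa [ht]))
  obtain ⟨e, he, hce⟩ := (h1.and (Ioo_mem_nhdsGT hd)).exists
  exact ⟨_, he, by rw [height_linePoint_self]; exact hce⟩

lemma IsBody.leftPiece {K : Set Plane} (hK : IsBody K) {θ c : ℝ} {x : Plane}
    (hx : x ∈ interior K) (hc : height θ x = c) : IsBody (leftPiece K θ c) where
  convex := convex_leftPiece hK.convex θ c
  isCompact := hK.isCompact.of_isClosed_subset (isClosed_leftPiece hK.isCompact.isClosed θ c)
    fun _ h => h.1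
  nonempty_interior := by
    obtain ⟨y, hy, hy1, -⟩ := exists_mem_open_height_gt isOpen_interior hx hc (lt_add_one c)
    rw [interior_leftPiece]
    exact ⟨y, hy, hy1⟩

/-- Beyond an area bisector, the left piece is strictly smaller than the right one. -/
lemma IsBody.area_leftPiece_lt_of_lt {K : Set Plane} (hK : IsBody K) {θ c d : ℝ}
    (h : IsAreaBisector K θ c) (hd : c < d) :
    area (_root_.leftPiece K θ d) < area (rightPiece K θ d) := by
  obtain ⟨x, hx, hxc⟩ := hK.exists_mem_interior_of_isAreaBisector h
  obtain ⟨y, hy, hy1, hy2⟩ := exists_mem_open_height_gt isOpen_interior hx hxc hd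
  have hO : IsOpen (interior K ∩ {z | c < height θ z ∧ height θ z < d}) := by
    refine isOpen_interior.inter (IsOpen.inter ?_ ?_)
    · exact isOpen_lt continuous_const (continuous_const.height continuous_id)
    · exact isOpen_lt (continuous_const.height continuous_id) continuous_const
  have hpos := hO.measure_pos volume ⟨y, hy, hy1, hy2⟩
  have hfin : area (rightPiece K θ c) ≠ ⊤ :=
    ne_top_of_le_ne_top hK.area_ne_top (measure_mono fun _ hz => hz.1)
  calc area (_root_.leftPiece K θ d) ≤ area (_root_.leftPiece K θ c) :=
        measure_mono (leftPiece_anti K θ hd.le)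
    _ = area (rightPiece K θ c) := h
    _ < area (rightPiece K θ c) + volume (interior K ∩ {z | c < height θ z ∧ height θ z < d}) :=
        ENNReal.lt_add_right hfin hpos.ne'
    _ = volume (rightPiece K θ c ∪ (interior K ∩ {z | c < height θ z ∧ height θ z < d})) := by
        refine (measure_union ?_ hO.measurableSet).symm
        exact disjoint_left.2 fun z hz hz' => hz.2.not_gt hz'.2.1
    _ ≤ area (rightPiece K θ d) := by
        refine measure_mono (union_subset (rightPiece_mono K θ hd.le) ?_)
        exact fun z hz => ⟨interior_subset hz.1, hz.2.2.le⟩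

lemma IsBody.area_rightPiece_lt_of_lt {K : Set Plane} (hK : IsBody K) {θ c d : ℝ}
    (h : IsAreaBisector K θ c) (hd : d < c) :
    area (rightPiece K θ d) < area (_root_.leftPiece K θ d) := by
  have := hK.area_leftPiece_lt_of_lt (θ := θ + Real.pi) (c := -c) (d := -d)
    (isAreaBisector_add_pi.2 (by rwa [neg_neg])) (neg_lt_neg hd)
  rwa [leftPiece_add_pi, rightPiece_add_pi, neg_neg] at this

lemma IsBody.isAreaBisector_unique {K : Set Plane} (hK : IsBody K) {θ c d : ℝ}
    (hc : IsAreaBisector K θ c) (hd : IsAreaBisector K θ d) : c = d := by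
  rcases lt_trichotomy c d with h | h | h
  · exact absurd hd (hK.area_leftPiece_lt_of_lt hc h).ne
  · exact h
  · exact absurd hd (hK.area_rightPiece_lt_of_lt hc h).ne'

/-! ### Continuous families of bodies -/

/-- A family of convex bodies depending continuously on a parameter: the bodies stay in a bounded
region, their union is closed in the total space, and so is the complement of the union of their
interiors. -/
structure IsBodyFamily {X : Type*} [TopologicalSpace X] (K : X → Set Plane) : Prop where
  isBody : ∀ x, IsBody (K x)
  isClosed_graph : IsClosed {z : X × Plane | z.2 ∈ K z.1}
  isOpen_interior_graph : IsOpen {z : X × Plane | z.2 ∈ interior (K z.1)}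
  bounded : ∃ R, ∀ x, K x ⊆ Metric.closedBall 0 R

lemma IsBody.isBodyFamily_const {X : Type*} [TopologicalSpace X] {K : Set Plane} (hK : IsBody K) :
    IsBodyFamily fun _ : X => K where
  isBody _ := hK
  isClosed_graph := hK.isCompact.isClosed.preimage continuous_snd
  isOpen_interior_graph := isOpen_interior.preimage continuous_snd
  bounded := by
    obtain ⟨R, hR⟩ := hK.isCompact.isBounded.subset_closedBall 0
    exact ⟨R, fun _ => hR⟩

section Family

variable {X : Type*} [TopologicalSpace X] {K : X → Set Plane} {θ c : X → ℝ}

lemma isClosed_graph_leftPiece (hK : IsClosed {z : X × Plane | z.2 ∈ K z.1}) (hθ : Continuous θ)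
    (hc : Continuous c) : IsClosed {z : X × Plane | z.2 ∈ leftPiece (K z.1) (θ z.1) (c z.1)} :=
  hK.inter (isClosed_le (hc.comp continuous_fst)
    ((hθ.comp continuous_fst).height continuous_snd))

lemma isOpen_graph_interior_leftPiece (hK : IsOpen {z : X × Plane | z.2 ∈ interior (K z.1)})
    (hθ : Continuous θ) (hc : Continuous c) :
    IsOpen {z : X × Plane | z.2 ∈ interior (leftPiece (K z.1) (θ z.1) (c z.1))} := by
  simp only [interior_leftPiece]
  exact hK.inter (isOpen_lt (hc.comp continuous_fst)
    ((hθ.comp continuous_fst).height continuous_snd))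

lemma IsBodyFamily.continuous_area_leftPiece [FirstCountableTopology X] (hK : IsBodyFamily K)
    (hθ : Continuous θ) (hc : Continuous c) :
    Continuous fun x => area (leftPiece (K x) (θ x) (c x)) := by
  obtain ⟨R, hR⟩ := hK.bounded
  refine continuous_iff_continuousAt.2 fun x₀ => ?_
  refine continuousAt_measure_of_graph (O := fun x => interior (leftPiece (K x) (θ x) (c x)))
    (B := Metric.closedBall 0 R) measurableSet_closedBall measure_closedBall_lt_top.ne
    (fun x y hy => hR x hy.1) (isClosed_graph_leftPiece hK.isClosed_graph hθ hc)
    (isOpen_graph_interior_leftPiece hK.isOpen_interior_graph hθ hc) (fun x => interior_subset) ?_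
  have hcl := isClosed_leftPiece (hK.isBody x₀).isCompact.isClosed (θ x₀) (c x₀)
  rw [← hcl.frontier_eq]
  exact (convex_leftPiece (hK.isBody x₀).convex _ _).addHaar_frontier volume

lemma IsBodyFamily.continuous_area_rightPiece [FirstCountableTopology X] (hK : IsBodyFamily K)
    (hθ : Continuous θ) (hc : Continuous c) :
    Continuous fun x => area (rightPiece (K x) (θ x) (c x)) := by
  simp only [area_rightPiece_add_pi]
  exact hK.continuous_area_leftPiece (hθ.add continuous_const) hc.neg

end Family

lemma IsBody.exists_isAreaBisector {K : Set Plane} (hK : IsBody K) (θ : ℝ) :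
    ∃ c, IsAreaBisector K θ c := by
  have hbd : IsCompact (height θ '' K) :=
    hK.isCompact.image (continuous_const.height continuous_id : Continuous (height θ))
  obtain ⟨a, ha⟩ := hbd.bddBelow
  obtain ⟨b, hb⟩ := hbd.bddAbove
  have hl := (hK.isBodyFamily_const (X := ℝ)).continuous_area_leftPiece
    (continuous_const (y := θ)) continuous_id
  have hr := (hK.isBodyFamily_const (X := ℝ)).continuous_area_rightPiece
    (continuous_const (y := θ)) continuous_id
  obtain ⟨c, hc⟩ := intermediate_value_univ₂ (a := b) (b := a) hl hr
    (measure_mono fun x hx => ⟨hx.1, hb ⟨x, hx.1, rfl⟩⟩)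
    (measure_mono fun x hx => ⟨hx.1, ha ⟨x, hx.1, rfl⟩⟩)
  exact ⟨c, hc⟩

/-- The offset of the area bisector of `K` with direction angle `θ` (zero if there is none). -/
noncomputable def bisectorOffset (K : Set Plane) (θ : ℝ) : ℝ :=
  Classical.epsilon fun c => IsAreaBisector K θ c

lemma IsBody.isAreaBisector_bisectorOffset {K : Set Plane} (hK : IsBody K) (θ : ℝ) :
    IsAreaBisector K θ (bisectorOffset K θ) :=
  Classical.epsilon_spec (hK.exists_isAreaBisector θ)

lemma IsBody.bisectorOffset_add_pi {K : Set Plane} (hK : IsBody K) (θ : ℝ) :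
    bisectorOffset K (θ + Real.pi) = -bisectorOffset K θ :=
  hK.isAreaBisector_unique (hK.isAreaBisector_bisectorOffset _)
    (isAreaBisector_add_pi.2 (by rw [neg_neg]; exact hK.isAreaBisector_bisectorOffset θ))

/-- The offset of the area bisector depends continuously on the body and on the direction: slightly
to either side of the bisector the two areas compare strictly, and this persists nearby. -/
lemma IsBodyFamily.continuous_bisectorOffset {X : Type*} [TopologicalSpace X]
    [FirstCountableTopology X] {K : X → Set Plane} (hK : IsBodyFamily K) {θ : X → ℝ}
    (hθ : Continuous θ) : Continuous fun x => bisectorOffset (K x) (θ x) := by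
  refine continuous_iff_continuousAt.2 fun x₀ => ?_
  refine tendsto_order.2 ⟨fun a ha => ?_, fun a ha => ?_⟩
  · have h := (hK.isBody x₀).area_rightPiece_lt_of_lt
      ((hK.isBody x₀).isAreaBisector_bisectorOffset (θ x₀)) ha
    filter_upwards [(hK.continuous_area_rightPiece hθ continuous_const).continuousAt.eventually_lt
      (hK.continuous_area_leftPiece hθ continuous_const).continuousAt h] with x hx
    by_contra! hle
    have hb := (hK.isBody x).isAreaBisector_bisectorOffset (θ x)
    refine hx.not_ge ((measure_mono (leftPiece_anti (K x) (θ x) hle)).trans (hb.le.trans ?_))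
    exact measure_mono (rightPiece_mono (K x) (θ x) hle)
  · have h := (hK.isBody x₀).area_leftPiece_lt_of_lt
      ((hK.isBody x₀).isAreaBisector_bisectorOffset (θ x₀)) ha
    filter_upwards [(hK.continuous_area_leftPiece hθ continuous_const).continuousAt.eventually_lt
      (hK.continuous_area_rightPiece hθ continuous_const).continuousAt h] with x hx
    by_contra! hle
    have hb := (hK.isBody x).isAreaBisector_bisectorOffset (θ x)
    refine hx.not_ge ((measure_mono (rightPiece_mono (K x) (θ x) hle)).trans (hb.ge.trans ?_))
    exact measure_mono (leftPiece_anti (K x) (θ x) hle)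

/-- The left half of `K`: the piece to the left of the area bisector with direction angle `θ`. -/
noncomputable def leftHalf (K : Set Plane) (θ : ℝ) : Set Plane :=
  leftPiece K θ (bisectorOffset K θ)

lemma IsBody.leftHalf_add_pi {K : Set Plane} (hK : IsBody K) (θ : ℝ) :
    leftHalf K (θ + Real.pi) = rightPiece K θ (bisectorOffset K θ) := by
  rw [leftHalf, leftPiece_add_pi, hK.bisectorOffset_add_pi, neg_neg]

lemma IsBody.leftHalf_add_two_pi {K : Set Plane} (hK : IsBody K) (θ : ℝ) :
    leftHalf K (θ + 2 * Real.pi) = leftHalf K θ := by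
  rw [two_mul, ← add_assoc, hK.leftHalf_add_pi, hK.bisectorOffset_add_pi, rightPiece_add_pi,
    neg_neg, leftHalf]

lemma IsBody.leftHalf {K : Set Plane} (hK : IsBody K) (θ : ℝ) : IsBody (leftHalf K θ) := by
  obtain ⟨x, hx, hxc⟩ :=
    hK.exists_mem_interior_of_isAreaBisector (hK.isAreaBisector_bisectorOffset θ)
  exact hK.leftPiece hx hxc

lemma IsBodyFamily.leftHalf {X : Type*} [TopologicalSpace X]
    [FirstCountableTopology X] {K : X → Set Plane} (hK : IsBodyFamily K) {θ : X → ℝ}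
    (hθ : Continuous θ) : IsBodyFamily fun x => leftHalf (K x) (θ x) where
  isBody x := (hK.isBody x).leftHalf (θ x)
  isClosed_graph :=
    isClosed_graph_leftPiece hK.isClosed_graph hθ (hK.continuous_bisectorOffset hθ)
  isOpen_interior_graph :=
    isOpen_graph_interior_leftPiece hK.isOpen_interior_graph hθ (hK.continuous_bisectorOffset hθ)
  bounded := by
    obtain ⟨R, hR⟩ := hK.bounded
    exact ⟨R, fun x y hy => hR x hy.1⟩

/-! ### Perimeters of pieces -/

lemma IsClosed.frontier_leftPiece {K : Set Plane} (hK : IsClosed K) (θ c : ℝ) :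
    frontier (leftPiece K θ c) = leftPiece (frontier K) θ c ∪ (K ∩ {x | height θ x = c}) := by
  rw [(isClosed_leftPiece hK θ c).frontier_eq, interior_leftPiece, hK.frontier_eq]
  ext x
  simp only [leftPiece, Set.mem_sdiff, mem_ofPred_eq, mem_inter_iff, mem_union, not_and, not_lt]
  constructor
  · rintro ⟨⟨h1, h2⟩, h3⟩
    by_cases hi : x ∈ interior K
    · exact Or.inr ⟨h1, le_antisymm (h3 hi) h2⟩
    · exact Or.inl ⟨⟨h1, hi⟩, h2⟩
  · rintro (⟨⟨h1, h2⟩, h3⟩ | ⟨h1, h2⟩)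
    · exact ⟨⟨h1, h3⟩, fun h => absurd h h2⟩
    · exact ⟨⟨h1, h2.ge⟩, fun _ => h2.le⟩

/-- A line through an interior point of a convex set meets the frontier in a null set. -/
lemma Convex.volume_linePoint_mem_frontier {K : Set Plane} (hK : Convex ℝ K) {θ c : ℝ} {x : Plane}
    (hx : x ∈ interior K) (hc : height θ x = c) :
    volume {t | linePoint θ c t ∈ frontier K} = 0 := by
  obtain ⟨s, hs⟩ := exists_linePoint_eq θ x
  rw [hc] at hs
  have hcomb : ∀ a b u v : ℝ, a + b = 1 →
      linePoint θ c (a * u + b * v) = a • linePoint θ c u + b • linePoint θ c v := by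
    intro a b u v hab
    ext i; fin_cases i
    · simp [linePoint]; linear_combination c * Real.sin θ * hab
    · simp [linePoint]; linear_combination -c * Real.cos θ * hab
  set T := {t | linePoint θ c t ∈ interior K} with hT
  have hTc : Convex ℝ T := by
    intro u hu v hv a b ha hb hab
    rw [hT, mem_ofPred_eq, smul_eq_mul, smul_eq_mul, hcomb a b u v hab]
    exact hK.interior hu hv ha hb hab
  refine measure_mono_null (fun t ht => ?_) (hTc.addHaar_frontier volume)
  refine ⟨?_, fun h => ht.2 (show linePoint θ c t ∈ interior K from interior_subset (s := T) h)⟩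
  -- points of the segment from the interior point to a frontier point are interior points
  have htend : Tendsto (fun a : ℝ => a * s + (1 - a) * t) (𝓝[>] 0) (𝓝 t) := by
    have : Tendsto (fun a : ℝ => a * s + (1 - a) * t) (𝓝 0) (𝓝 (0 * s + (1 - 0) * t)) :=
      (by fun_prop : Continuous fun a : ℝ => a * s + (1 - a) * t).tendsto 0
    rw [zero_mul, zero_add, sub_zero, one_mul] at this
    exact this.mono_left nhdsWithin_le_nhds
  refine mem_closure_of_tendsto htend ?_
  filter_upwards [Ioo_mem_nhdsGT (zero_lt_one (α := ℝ))] with a ha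
  rw [hT, mem_ofPred_eq, hcomb a (1 - a) s t (by ring), hs]
  exact hK.openSegment_interior_closure_subset_interior hx ht.1
    ⟨a, 1 - a, ha.1, by linarith [ha.2], by ring, rfl⟩

lemma Convex.hausdorffMeasure_frontier_inter_line {K : Set Plane} (hK : Convex ℝ K) {θ c : ℝ}
    {x : Plane} (hx : x ∈ interior K) (hc : height θ x = c) :
    μH[1] (frontier K ∩ {y | height θ y = c}) = 0 := by
  rw [hausdorffMeasure_inter_line, hK.volume_linePoint_mem_frontier hx hc]

/-- The part of the line with direction angle `θ` and offset `c` inside `K`, in its arc length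
parameter. -/
def lineSection (K : Set Plane) (θ c : ℝ) : Set ℝ := {t | linePoint θ c t ∈ K}

lemma IsBody.perimeter_leftPiece {K : Set Plane} (hK : IsBody K) {θ c : ℝ} {x : Plane}
    (hx : x ∈ interior K) (hc : height θ x = c) :
    perimeter (_root_.leftPiece K θ c) =
      μH[1] (_root_.leftPiece (frontier K) θ c) + volume (lineSection K θ c) := by
  rw [perimeter, hK.isCompact.isClosed.frontier_leftPiece, measure_union₀, lineSection,
    ← hausdorffMeasure_inter_line]
  · exact (hK.isCompact.isClosed.inter (isClosed_eq (continuous_const.height continuous_id)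
      continuous_const)).measurableSet.nullMeasurableSet
  · exact measure_mono_null (t := frontier K ∩ {y | height θ y = c})
      (fun y hy => ⟨hy.1.1, hy.2.2⟩)
      (hK.convex.hausdorffMeasure_frontier_inter_line hx hc)

/-- The perimeter of a piece cut off twice: a part of the original boundary and two chords. -/
lemma IsBody.perimeter_leftPiece_leftPiece {K : Set Plane} (hK : IsBody K) {θ c φ d : ℝ}
    {x y : Plane} (hx : x ∈ interior K) (hc : height θ x = c)
    (hy : y ∈ interior (_root_.leftPiece K θ c)) (hd : height φ y = d) :
    perimeter (_root_.leftPiece (_root_.leftPiece K θ c) φ d) =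
      μH[1] (_root_.leftPiece (_root_.leftPiece (frontier K) θ c) φ d) +
      volume (lineSection (_root_.leftPiece K φ d) θ c) +
      volume (lineSection (_root_.leftPiece K θ c) φ d) := by
  rw [(hK.leftPiece hx hc).perimeter_leftPiece hy hd, hK.isCompact.isClosed.frontier_leftPiece]
  congr 1
  have hsplit : _root_.leftPiece
      (_root_.leftPiece (frontier K) θ c ∪ (K ∩ {x | height θ x = c})) φ d
      = _root_.leftPiece (_root_.leftPiece (frontier K) θ c) φ d ∪
        (_root_.leftPiece K φ d ∩ {x | height θ x = c}) := by
    ext z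
    simp only [_root_.leftPiece, mem_union, mem_ofPred_eq, mem_inter_iff]
    tauto
  rw [hsplit, measure_union₀, lineSection, ← hausdorffMeasure_inter_line]
  · exact ((isClosed_leftPiece hK.isCompact.isClosed φ d).inter (isClosed_eq
      (continuous_const.height continuous_id) continuous_const)).measurableSet.nullMeasurableSet
  · exact measure_mono_null (t := frontier K ∩ {y | height θ y = c})
      (fun y hy => ⟨hy.1.1.1, hy.2.2⟩)
      (hK.convex.hausdorffMeasure_frontier_inter_line hx hc)

lemma lineSection_subset {K : Set Plane} {R : ℝ} (hK : K ⊆ Metric.closedBall 0 R) (θ c : ℝ) :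
    lineSection K θ c ⊆ Icc (-R) R := by
  intro t ht
  have h1 : ‖linePoint θ c t‖ ≤ R := by simpa using hK ht
  have h2 := norm_sq_linePoint θ c t
  have h3 : |t| ≤ ‖linePoint θ c t‖ := abs_le_of_sq_le_sq (by nlinarith) (norm_nonneg _)
  exact abs_le.1 (h3.trans h1)

lemma IsBody.volume_lineSection_ne_top {K : Set Plane} (hK : IsBody K) (θ c : ℝ) :
    volume (lineSection K θ c) ≠ ⊤ := by
  obtain ⟨R, hR⟩ := hK.isCompact.isBounded.subset_closedBall 0
  exact ne_top_of_le_ne_top (by simp : volume (Icc (-R) R) ≠ ⊤)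
    (measure_mono (lineSection_subset hR θ c))

section Family

variable {X : Type*} [TopologicalSpace X] [FirstCountableTopology X]
  {K : Set Plane} {θ c φ d : X → ℝ}

/-- The chord cut by a moving line from a piece with moving straight side has continuous length,
as long as the two lines are distinct and the first one meets the interior. -/
lemma IsBody.continuousAt_volume_lineSection (hK : IsBody K) (hθ : Continuous θ)
    (hc : Continuous c) (hφ : Continuous φ) (hd : Continuous d) {x₀ : X} {y : Plane}
    (hy : y ∈ interior K) (hyc : height (θ x₀) y = c x₀)
    (hne : ¬ (Real.sin (φ x₀ - θ x₀) = 0 ∧ c x₀ * Real.cos (φ x₀ - θ x₀) = d x₀)) :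
    ContinuousAt
      (fun x => volume (lineSection (_root_.leftPiece K (φ x) (d x)) (θ x) (c x))) x₀ := by
  obtain ⟨R, hR⟩ := hK.isCompact.isBounded.subset_closedBall 0
  have hpt : Continuous fun z : X × ℝ => linePoint (θ z.1) (c z.1) z.2 := by fun_prop
  have hmap : Continuous fun z : X × ℝ => (z.1, linePoint (θ z.1) (c z.1) z.2) :=
    continuous_fst.prodMk hpt
  refine continuousAt_measure_of_graph (B := Icc (-R) R)
    (S := fun x => lineSection (_root_.leftPiece K (φ x) (d x)) (θ x) (c x))
    (O := fun x => lineSection (interior (_root_.leftPiece K (φ x) (d x))) (θ x) (c x))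
    measurableSet_Icc (by simp)
    (fun x => lineSection_subset (fun z hz => hR hz.1) (θ x) (c x))
    ((isClosed_graph_leftPiece (K := fun _ : X => K) hK.isBodyFamily_const.isClosed_graph
      hφ hd).preimage hmap)
    ((isOpen_graph_interior_leftPiece (K := fun _ : X => K)
      hK.isBodyFamily_const.isOpen_interior_graph
      hφ hd).preimage hmap)
    (fun x t ht => interior_subset (s := _root_.leftPiece K (φ x) (d x)) ht)
    ?_
  have hsub : {t | height (φ x₀) (linePoint (θ x₀) (c x₀) t) = d x₀}.Subsingleton := by
    intro s hs t ht
    simp only [mem_ofPred_eq, height_linePoint] at hs ht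
    by_contra hst
    have h0 : (s - t) * Real.sin (φ x₀ - θ x₀) = 0 := by linarith
    have h1 : Real.sin (φ x₀ - θ x₀) = 0 := (mul_eq_zero.1 h0).resolve_left (sub_ne_zero.2 hst)
    rw [h1] at hs
    exact hne ⟨h1, by linarith⟩
  refine measure_mono_null (t := {t | linePoint (θ x₀) (c x₀) t ∈ frontier K} ∪
    {t | height (φ x₀) (linePoint (θ x₀) (c x₀) t) = d x₀}) ?_
    (measure_union_null (hK.convex.volume_linePoint_mem_frontier hy hyc)
      (hsub.measure_zero volume))
  rintro t ⟨ht, ht'⟩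
  rw [interior_leftPiece] at ht'
  by_cases hi : linePoint (θ x₀) (c x₀) t ∈ interior K
  · right
    by_contra hne'
    exact ht' ⟨hi, lt_of_le_of_ne ht.2 (Ne.symm hne')⟩
  · exact Or.inl ⟨subset_closure ht.1, hi⟩

/-- The part of the boundary cut out by two moving half planes has continuous length, as long as
their boundary lines meet the interior. -/
lemma IsBody.continuousAt_hausdorffMeasure_frontier (hK : IsBody K)
    (hfin : perimeter K ≠ ⊤) (hθ : Continuous θ)
    (hc : Continuous c) (hφ : Continuous φ) (hd : Continuous d) {x₀ : X} {y z : Plane}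
    (hy : y ∈ interior K) (hyc : height (θ x₀) y = c x₀)
    (hz : z ∈ interior K) (hzd : height (φ x₀) z = d x₀) :
    ContinuousAt (fun x => μH[1] (_root_.leftPiece (_root_.leftPiece (frontier K) (θ x) (c x))
      (φ x) (d x))) x₀ := by
  have hcl : ∀ x, IsClosed (_root_.leftPiece (_root_.leftPiece univ (θ x) (c x)) (φ x) (d x)) :=
    fun x => isClosed_leftPiece (isClosed_leftPiece isClosed_univ _ _) _ _
  have heq : ∀ x, μH[1] (_root_.leftPiece (_root_.leftPiece (frontier K) (θ x) (c x)) (φ x) (d x)) =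
      (μH[1].restrict (frontier K))
        (_root_.leftPiece (_root_.leftPiece univ (θ x) (c x)) (φ x) (d x)) := by
    intro x
    rw [Measure.restrict_apply (hcl x).measurableSet]
    congr 1
    ext w
    simp only [_root_.leftPiece, mem_univ, true_and, mem_inter_iff, mem_ofPred_eq]
    tauto
  simp only [heq]
  refine continuousAt_measure_of_graph (B := univ)
    (O := fun x => interior (_root_.leftPiece (_root_.leftPiece univ (θ x) (c x)) (φ x) (d x)))
    MeasurableSet.univ (by rwa [Measure.restrict_apply_univ])
    (fun x => subset_univ _)
    (isClosed_graph_leftPiece (K := fun x => _root_.leftPiece univ (θ x) (c x))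
      (isClosed_graph_leftPiece (K := fun _ => univ)
      isClosed_univ hθ hc) hφ hd)
    (isOpen_graph_interior_leftPiece (K := fun x => _root_.leftPiece univ (θ x) (c x))
      (isOpen_graph_interior_leftPiece (K := fun _ => univ) (by simp) hθ hc) hφ hd)
    (fun x => interior_subset) ?_
  rw [Measure.restrict_apply ((hcl x₀).measurableSet.diff isOpen_interior.measurableSet)]
  refine measure_mono_null ?_ (measure_union_null
    (hK.convex.hausdorffMeasure_frontier_inter_line hy hyc)
    (hK.convex.hausdorffMeasure_frontier_inter_line hz hzd))
  rintro w ⟨⟨hw, hw'⟩, hwK⟩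
  rw [interior_leftPiece, interior_leftPiece, interior_univ] at hw'
  by_cases h1 : height (θ x₀) w = c x₀
  · exact Or.inl ⟨hwK, h1⟩
  · right
    refine ⟨hwK, ?_⟩
    by_contra h2
    exact hw' ⟨⟨mem_univ _, lt_of_le_of_ne hw.1.2 (Ne.symm h1)⟩, lt_of_le_of_ne hw.2 (Ne.symm h2)⟩

end Family

lemma IsBody.exists_mem_interior_height_bisectorOffset {K : Set Plane} (hK : IsBody K) (θ : ℝ) :
    ∃ x ∈ interior K, height θ x = bisectorOffset K θ :=
  hK.exists_mem_interior_of_isAreaBisector (hK.isAreaBisector_bisectorOffset θ)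

/-- The left half, in direction `φ`, of the left half of `K` in direction `θ`. -/
noncomputable def quarter (K : Set Plane) (θ φ : ℝ) : Set Plane := leftHalf (leftHalf K θ) φ

lemma IsBody.perimeter_quarter {K : Set Plane} (hK : IsBody K) (θ φ : ℝ) :
    perimeter (quarter K θ φ) =
      μH[1] (_root_.leftPiece (_root_.leftPiece (frontier K) θ (bisectorOffset K θ)) φ
        (bisectorOffset (_root_.leftHalf K θ) φ)) +
      volume (lineSection (_root_.leftPiece K φ (bisectorOffset (_root_.leftHalf K θ) φ)) θ
        (bisectorOffset K θ)) +
      volume (lineSection (_root_.leftPiece K θ (bisectorOffset K θ)) φ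
        (bisectorOffset (_root_.leftHalf K θ) φ)) := by
  obtain ⟨x, hx, hxc⟩ := hK.exists_mem_interior_height_bisectorOffset θ
  obtain ⟨y, hy, hyd⟩ := (hK.leftHalf θ).exists_mem_interior_height_bisectorOffset φ
  exact hK.perimeter_leftPiece_leftPiece hx hxc hy hyd

lemma IsBody.perimeter_quarter_ne_top {K : Set Plane} (hK : IsBody K) (hfin : perimeter K ≠ ⊤)
    (θ φ : ℝ) : perimeter (quarter K θ φ) ≠ ⊤ := by
  rw [hK.perimeter_quarter]
  refine ENNReal.add_ne_top.2 ⟨ENNReal.add_ne_top.2 ⟨?_, ?_⟩, ?_⟩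
  · exact ne_top_of_le_ne_top hfin (measure_mono fun x hx => hx.1.1)
  · exact ne_top_of_le_ne_top (hK.volume_lineSection_ne_top _ _) (measure_mono fun x hx => hx.1)
  · exact ne_top_of_le_ne_top (hK.volume_lineSection_ne_top _ _) (measure_mono fun x hx => hx.1)

lemma IsBody.continuous_perimeter_quarter {K : Set Plane} (hK : IsBody K)
    (hfin : perimeter K ≠ ⊤) : Continuous fun z : ℝ × ℝ => perimeter (quarter K z.1 z.2) := by
  simp only [hK.perimeter_quarter]
  refine continuous_iff_continuousAt.2 fun z => ?_
  have hKf := hK.isBodyFamily_const (X := ℝ × ℝ)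
  have hθ : Continuous fun z : ℝ × ℝ => z.1 := continuous_fst
  have hφ : Continuous fun z : ℝ × ℝ => z.2 := continuous_snd
  have hc := hKf.continuous_bisectorOffset hθ
  have hd := (hKf.leftHalf hθ).continuous_bisectorOffset hφ
  obtain ⟨x, hx, hxc⟩ := hK.exists_mem_interior_height_bisectorOffset z.1
  obtain ⟨y, hy, hyd⟩ := (hK.leftHalf z.1).exists_mem_interior_height_bisectorOffset z.2
  have hy' := hy
  rw [_root_.leftHalf, interior_leftPiece] at hy'
  obtain ⟨hyK, hyc⟩ := hy'
  -- if the two bisecting lines coincided, the second one could not meet the open half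
  obtain ⟨t, ht⟩ := exists_linePoint_eq z.1 y
  have hh : Real.sin (z.2 - z.1) = 0 →
      height z.2 y = height z.1 y * Real.cos (z.2 - z.1) := by
    intro h0
    conv_lhs => rw [← ht, height_linePoint, h0]
    ring
  have hcos : Real.sin (z.2 - z.1) = 0 → Real.cos (z.2 - z.1) ^ 2 = 1 := by
    intro h0
    have := Real.sin_sq_add_cos_sq (z.2 - z.1)
    rw [h0] at this; linarith
  have hyc' : bisectorOffset K z.1 < height z.1 y := hyc
  refine ((hK.continuousAt_hausdorffMeasure_frontier hfin hθ hc hφ hd hx hxc hyK hyd).add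
    (hK.continuousAt_volume_lineSection hθ hc hφ hd hx hxc ?_)).add
    (hK.continuousAt_volume_lineSection hφ hd hθ hc hyK hyd ?_)
  · rintro ⟨h0, h1⟩
    have e := hh h0
    rw [hyd, ← h1] at e
    have : (height z.1 y - bisectorOffset K z.1) * Real.cos (z.2 - z.1) ^ 2 = 0 := by
      linear_combination (-Real.cos (z.2 - z.1)) * e
    rw [hcos h0] at this
    linarith
  · rintro ⟨h0, h1⟩
    rw [← neg_sub, Real.sin_neg, neg_eq_zero] at h0
    rw [← neg_sub, Real.cos_neg, ← hyd, hh h0, mul_assoc, ← sq, hcos h0, mul_one] at h1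
    linarith

/-! ### Finite perimeter of polygons -/

/-- A boundary point of a convex hull in the plane lies on a segment between two of the given
points: by Carathéodory's theorem it lies in an affinely independent simplex, and a triangle with
positive coordinates would make it an interior point. -/
lemma frontier_convexHull_subset_iUnion_segment {s : Set Plane}
    (hs : IsClosed (convexHull ℝ s)) :
    frontier (convexHull ℝ s) ⊆ ⋃ a ∈ s, ⋃ b ∈ s, segment ℝ a b := by
  intro x hx
  have hxs : x ∈ convexHull ℝ s := hs.frontier_subset hx
  obtain ⟨ι, _, z, w, hz, hind, hw, hw1, rfl⟩ := eq_pos_convex_span_of_mem_convexHull hxs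
  have hcard : Fintype.card ι ≤ 3 := by
    have := hind.card_le_finrank_succ
    have h2 := Submodule.finrank_le (vectorSpan ℝ (range z))
    rw [finrank_euclideanSpace_fin] at h2
    omega
  have hcard3 : Fintype.card ι ≠ 3 := by
    intro h3
    have htop : affineSpan ℝ (range z) = ⊤ := by
      rw [hind.affineSpan_eq_top_iff_card_eq_finrank_add_one, h3, finrank_euclideanSpace_fin]
    let b : AffineBasis ι ℝ Plane := ⟨z, hind, htop⟩
    refine hx.2 (interior_mono (convexHull_mono hz) ?_)
    change _ ∈ interior (convexHull ℝ (range b))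
    rw [b.interior_convexHull]
    intro i
    have : ∑ i, w i • z i = Finset.univ.affineCombination ℝ b w := by
      rw [Finset.affineCombination_eq_linear_combination _ _ _ hw1]; rfl
    rw [this, b.coord_apply_combination_of_mem (Finset.mem_univ i) hw1]
    exact hw i
  have hne : Nonempty ι := by
    by_contra h
    rw [not_nonempty_iff] at h
    simp at hw1
  obtain ⟨i⟩ := hne
  simp only [mem_iUnion]
  by_cases hsub : ∀ j, j = i
  · refine ⟨z i, hz ⟨i, rfl⟩, z i, hz ⟨i, rfl⟩, ?_⟩
    have : Unique ι := ⟨⟨i⟩, hsub⟩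
    rw [Fintype.sum_unique] at hw1 ⊢
    rw [hw1, one_smul, hsub default]
    exact left_mem_segment ℝ _ _
  · push Not at hsub
    obtain ⟨j, hj⟩ := hsub
    classical
    have huniv : (Finset.univ : Finset ι) = {i, j} := by
      symm
      rw [← Finset.card_eq_iff_eq_univ, Finset.card_pair hj.symm]
      have h2 : 1 < Fintype.card ι := Fintype.one_lt_card_iff.2 ⟨i, j, hj.symm⟩
      omega
    refine ⟨z i, hz ⟨i, rfl⟩, z j, hz ⟨j, rfl⟩, w i, w j, (hw i).le, (hw j).le, ?_, ?_⟩
    · rw [← hw1, huniv, Finset.sum_pair hj.symm]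
    · rw [huniv, Finset.sum_pair hj.symm]

lemma IsConvexPolygon.isBody {P : Set Plane} (hP : IsConvexPolygon P) : IsBody P := by
  obtain ⟨⟨s, hs, rfl⟩, hne⟩ := hP
  exact ⟨convex_convexHull ℝ s, hs.isCompact_convexHull ℝ, hne⟩

lemma IsConvexPolygon.perimeter_ne_top {P : Set Plane} (hP : IsConvexPolygon P) :
    perimeter P ≠ ⊤ := by
  obtain ⟨⟨s, hs, rfl⟩, -⟩ := hP
  refine ne_top_of_le_ne_top ?_ (measure_mono
    (frontier_convexHull_subset_iUnion_segment (hs.isCompact_convexHull ℝ).isClosed))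
  refine ((measure_biUnion_lt_top hs fun a _ => measure_biUnion_lt_top hs fun b _ => ?_)).ne
  rw [hausdorffMeasure_segment]
  exact edist_lt_top a b

/-! ### The fair partition -/

lemma IsBody.area_leftHalf {K : Set Plane} (hK : IsBody K) (θ : ℝ) :
    2 * area (_root_.leftHalf K θ) = area K := by
  have hb := hK.isAreaBisector_bisectorOffset θ
  set c := bisectorOffset K θ with hc
  have hunion : area K = area (_root_.leftPiece K θ c) + area (rightPiece K θ c) := by
    conv_lhs => rw [← leftPiece_union_rightPiece K θ c]
    refine measure_union₀ (isClosed_rightPiece hK.isCompact.isClosed θ c).nullMeasurableSet ?_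
    -- the common side lies in the frontier of the left piece
    refine measure_mono_null (fun x hx => ?_)
      ((convex_leftPiece hK.convex θ c).addHaar_frontier volume)
    rw [hK.isCompact.isClosed.frontier_leftPiece]
    exact Or.inr ⟨hx.1.1, le_antisymm hx.2.2 hx.1.2⟩
  rw [hunion, ← hb, two_mul]
  rfl

lemma IsBody.quarter_add_two_pi_left {K : Set Plane} (hK : IsBody K) (θ φ : ℝ) :
    quarter K (θ + 2 * Real.pi) φ = quarter K θ φ := by
  rw [quarter, hK.leftHalf_add_two_pi, quarter]

lemma IsBody.quarter_add_two_pi_right {K : Set Plane} (hK : IsBody K) (θ φ : ℝ) :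
    quarter K θ (φ + 2 * Real.pi) = quarter K θ φ :=
  (hK.leftHalf θ).leftHalf_add_two_pi φ

/-- Rotating the direction by `π` exchanges the two halves of a body. So there is a bisector with
fair bisectors of its two halves such that all four resulting perimeters agree. -/
lemma exists_perimeter_quarter_eq {K : Set Plane} (hK : IsBody K) (hfin : perimeter K ≠ ⊤) :
    ∃ θ ∈ Ico 0 (2 * Real.pi), ∃ φ ψ,
      perimeter (quarter K θ φ) = perimeter (quarter K θ (φ + Real.pi)) ∧
      perimeter (quarter K (θ + Real.pi) ψ) =
        perimeter (quarter K (θ + Real.pi) (ψ + Real.pi)) ∧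
      perimeter (quarter K θ φ) = perimeter (quarter K (θ + Real.pi) ψ) := by
  have hcont : Continuous fun z : ℝ × ℝ => (perimeter (quarter K z.1 z.2)).toReal :=
    ENNReal.continuousOn_toReal.comp_continuous (hK.continuous_perimeter_quarter hfin)
      fun z => hK.perimeter_quarter_ne_top hfin z.1 z.2
  obtain ⟨θ, φ, ψ, h⟩ := exists_antiperiodic_coincidence
    (fun θ φ => (perimeter (quarter K θ φ)).toReal) hcont
    (fun θ φ => by rw [hK.quarter_add_two_pi_left])
    (fun θ φ => by rw [hK.quarter_add_two_pi_right])
  have hinj : ∀ {θ φ θ' φ'}, (perimeter (quarter K θ φ)).toReal =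
      (perimeter (quarter K θ' φ')).toReal → perimeter (quarter K θ φ) =
      perimeter (quarter K θ' φ') := fun h =>
    (ENNReal.toReal_eq_toReal_iff' (hK.perimeter_quarter_ne_top hfin _ _)
      (hK.perimeter_quarter_ne_top hfin _ _)).1 h
  have hper : Function.Periodic (fun θ => ∃ φ ψ,
      perimeter (quarter K θ φ) = perimeter (quarter K θ (φ + Real.pi)) ∧
      perimeter (quarter K (θ + Real.pi) ψ) =
        perimeter (quarter K (θ + Real.pi) (ψ + Real.pi)) ∧
      perimeter (quarter K θ φ) = perimeter (quarter K (θ + Real.pi) ψ)) (2 * Real.pi) := by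
    intro θ
    simp only [add_right_comm θ (2 * Real.pi), hK.quarter_add_two_pi_left]
  obtain ⟨θ', hθ', he⟩ := hper.exists_mem_Ico₀ (by positivity) θ
  exact ⟨θ', hθ', he.mp ⟨φ, ψ, hinj h.1, hinj h.2.1, hinj h.2.2⟩⟩

lemma disjoint_interior_leftPiece_rightPiece (K : Set Plane) (θ c : ℝ) :
    Disjoint (interior (leftPiece K θ c)) (interior (rightPiece K θ c)) := by
  rw [interior_leftPiece, interior_rightPiece]
  exact disjoint_left.2 fun x hx hx' => lt_asymm (show c < height θ x from hx.2) hx'.2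

lemma isConvexFairPartition_of_four {P A B C D : Set Plane}
    (hcc : ∀ S, S = A ∨ S = B ∨ S = C ∨ S = D → IsClosed S ∧ Convex ℝ S)
    (hU : A ∪ B ∪ C ∪ D = P) (hAB : Disjoint (interior A) (interior B))
    (hAC : Disjoint (interior A) (interior C)) (hAD : Disjoint (interior A) (interior D))
    (hBC : Disjoint (interior B) (interior C)) (hBD : Disjoint (interior B) (interior D))
    (hCD : Disjoint (interior C) (interior D)) (hB : area B = area A) (hC : area C = area A)
    (hD : area D = area A) (hB' : perimeter B = perimeter A) (hC' : perimeter C = perimeter A)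
    (hD' : perimeter D = perimeter A) : IsConvexFairPartition P ![A, B, C, D] := by
  have hmem : ∀ i, ![A, B, C, D] i = A ∨ ![A, B, C, D] i = B ∨ ![A, B, C, D] i = C ∨
      ![A, B, C, D] i = D := by
    intro i; fin_cases i <;> simp
  refine ⟨fun i => (hcc _ (hmem i)).1, fun i => (hcc _ (hmem i)).2, ?_, ?_, ?_, ?_⟩
  · rw [← hU]
    ext x
    simp [Fin.exists_fin_succ, or_assoc]
  · intro i j hij
    fin_cases i <;> fin_cases j <;> first
      | exact absurd rfl hij
      | assumption
      | (apply Disjoint.symm; assumption)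
  · have h : ∀ i, area (![A, B, C, D] i) = area A := by
      intro i; fin_cases i
      exacts [rfl, hB, hC, hD]
    intro i j; rw [h i, h j]
  · have h : ∀ i, perimeter (![A, B, C, D] i) = perimeter A := by
      intro i; fin_cases i
      exacts [rfl, hB', hC', hD']
    intro i j; rw [h i, h j]

/-- Cutting the two halves of `K` by area bisectors yields a convex fair partition, provided that
all four perimeters agree. -/
lemma IsBody.isConvexFairPartition {K : Set Plane} (hK : IsBody K) {θ φ ψ : ℝ}
    (h1 : perimeter (quarter K θ φ) = perimeter (quarter K θ (φ + Real.pi)))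
    (h2 : perimeter (quarter K (θ + Real.pi) ψ) =
      perimeter (quarter K (θ + Real.pi) (ψ + Real.pi)))
    (h3 : perimeter (quarter K θ φ) = perimeter (quarter K (θ + Real.pi) ψ)) :
    IsConvexFairPartition K ![quarter K θ φ, quarter K θ (φ + Real.pi),
      quarter K (θ + Real.pi) ψ, quarter K (θ + Real.pi) (ψ + Real.pi)] := by
  have hA := hK.leftHalf θ
  have hB := hK.leftHalf (θ + Real.pi)
  have hbody : ∀ α β, IsBody (quarter K α β) := fun α β => (hK.leftHalf α).leftHalf β
  have harea : ∀ α β, 2 * (2 * area (quarter K α β)) = area K := fun α β => by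
    rw [quarter, (hK.leftHalf α).area_leftHalf, hK.area_leftHalf]
  have harea' : ∀ α β α' β', area (quarter K α β) = area (quarter K α' β') := by
    intro α β α' β'
    have h := (harea α β).trans (harea α' β').symm
    rwa [ENNReal.mul_right_inj two_ne_zero ENNReal.ofNat_ne_top,
      ENNReal.mul_right_inj two_ne_zero ENNReal.ofNat_ne_top] at h
  have hunion : ∀ {L : Set Plane}, IsBody L → ∀ α,
      _root_.leftHalf L α ∪ _root_.leftHalf L (α + Real.pi) = L := fun hL α => by
    rw [hL.leftHalf_add_pi]; exact leftPiece_union_rightPiece _ _ _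
  have hdisj : ∀ {L : Set Plane}, IsBody L → ∀ α,
      Disjoint (interior (_root_.leftHalf L α)) (interior (_root_.leftHalf L (α + Real.pi))) :=
    fun hL α => by
    rw [hL.leftHalf_add_pi]; exact disjoint_interior_leftPiece_rightPiece _ _ _
  have hsub : ∀ α β, interior (quarter K α β) ⊆ interior (_root_.leftHalf K α) := fun α β =>
    interior_mono fun x hx => hx.1
  have hcross : ∀ β β', Disjoint (interior (quarter K θ β))
      (interior (quarter K (θ + Real.pi) β')) := fun β β' =>
    (hdisj hK θ).mono (hsub θ β) (hsub _ β')
  refine isConvexFairPartition_of_four (fun S hS => ?_) ?_ (hdisj hA φ) (hcross _ _) (hcross _ _)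
    (hcross _ _) (hcross _ _) (hdisj hB ψ) (harea' _ _ _ _) (harea' _ _ _ _) (harea' _ _ _ _)
    h1.symm h3.symm (h3.trans h2).symm
  · rcases hS with rfl | rfl | rfl | rfl
    all_goals exact ⟨(hbody _ _).isCompact.isClosed, (hbody _ _).convex⟩
  · have e1 : quarter K θ φ ∪ quarter K θ (φ + Real.pi) = _root_.leftHalf K θ := hunion hA φ
    have e2 : quarter K (θ + Real.pi) ψ ∪ quarter K (θ + Real.pi) (ψ + Real.pi) =
      _root_.leftHalf K (θ + Real.pi) := hunion hB ψ
    rw [union_assoc, e2, e1, hunion hK θ]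

theorem mainTheorem1 (P : Set Plane) (hP : IsConvexPolygon P) :
    ∃ θ ∈ Set.Ico (0 : ℝ) (2 * Real.pi), ∃ c θA cA θB cB : ℝ, ∃ A B A₁ A₂ B₁ B₂ : Set Plane,
      -- the rotating area bisector, at angle `θ`, cuts `P` into `A` and `B`
      IsAreaBisector P θ c ∧ A = leftPiece P θ c ∧ B = rightPiece P θ c ∧
      -- a fair bisector of `A` cuts it into `A₁` and `A₂`
      IsFairBisector A θA cA ∧ A₁ = leftPiece A θA cA ∧ A₂ = rightPiece A θA cA ∧
      -- a fair bisector of `B` cuts it into `B₁` and `B₂`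
      IsFairBisector B θB cB ∧ B₁ = leftPiece B θB cB ∧ B₂ = rightPiece B θB cB ∧
      -- both pairs have the same common perimeter, and the four pieces form
      -- a convex fair partition of `P`
      perimeter A₁ = perimeter B₁ ∧ IsConvexFairPartition P ![A₁, A₂, B₁, B₂] := by
  have hK := hP.isBody
  obtain ⟨θ, hθ, φ, ψ, h1, h2, h3⟩ := exists_perimeter_quarter_eq hK hP.perimeter_ne_top
  have hA := hK.leftHalf θ
  have hB := hK.leftHalf (θ + Real.pi)
  refine ⟨θ, hθ, bisectorOffset P θ, φ, bisectorOffset (leftHalf P θ) φ, ψ,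
    bisectorOffset (leftHalf P (θ + Real.pi)) ψ, leftHalf P θ, leftHalf P (θ + Real.pi),
    quarter P θ φ, quarter P θ (φ + Real.pi), quarter P (θ + Real.pi) ψ,
    quarter P (θ + Real.pi) (ψ + Real.pi), hK.isAreaBisector_bisectorOffset θ, rfl,
    hK.leftHalf_add_pi θ, ⟨hA.isAreaBisector_bisectorOffset φ, ?_⟩, rfl, hA.leftHalf_add_pi φ,
    ⟨hB.isAreaBisector_bisectorOffset ψ, ?_⟩, rfl, hB.leftHalf_add_pi ψ, h3,
    hK.isConvexFairPartition h1 h2 h3⟩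
  · rw [← hA.leftHalf_add_pi φ]; exact h1
  · rw [← hB.leftHalf_add_pi ψ]; exact h2
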